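/- Let $\mathbb{R}^\infty=\prod_{i=1}^\infty\mathbb{R}$ carry the product topology, and let $$\Delta^\infty_0=\Big\{x\in\mathbb{R}^\infty \;:\; x_i\ge 0 \text{ for all } i,\ \sum_{i=1}^\infty x_i\le 1\Big\}$$ carry the subspace topology. If $f:\Delta^\infty_0\to\Delta^\infty_0$ is continuous, then $f$ has a fixed point, i.e. there is $x\in\Delta^\infty_0$ with $f(x)=x$. -/

import Mathlib

/-- The standard infinite-dimensional simplex in `ℝ^∞ = ℕ → ℝ` (with the product topology):
all sequences of non-negative reals whose series converges with sum at most `1`.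
Coordinates are indexed from `0`. -/
def infSimplex : Set (ℕ → ℝ) :=
  {x | (∀ i, 0 ≤ x i) ∧ Summable x ∧ ∑' i, x i ≤ 1}

/-!
A continuous self-map of the infinite simplex is approximated by its truncations to the first `n`
coordinates, which are continuous self-maps of a finite-dimensional simplex. A fixed point of the
`n`-th truncation is a point of `infSimplex` whose first `n` coordinates are preserved by `f`. Since
`infSimplex` is compact and metrizable, a subsequence of these points converges, and its limit is
fixed by `f`.

The finite-dimensional case, Brouwer's theorem for `stdSimplex ℝ ι`, is proved through Scarf's
combinatorial lemma. Take the finite grid of points with coordinates in `k⁻¹ ℕ`, rank it by each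
coordinate, and colour a grid point `p` by some `i` with `p i ≤ f p i`. Scarf's lemma
(`exists_dominant_colours`) yields a nonempty set `σ` of grid points such that no grid point exceeds
the minimum over `σ` in every coordinate that occurs as a colour in `σ`. As the coordinates sum to
`1`, this forces `σ` to have diameter `O(1 / k)` and the coordinates that are not colours to be
`O(1 / k)` on `σ` (`grid_close_of_dominant`). A limit point `x` for `k → ∞` satisfies `x i ≤ f x i`
for all `i`, and since both sides sum to `1` they agree.

Scarf's lemma is a parity argument like the one for Sperner's lemma, but without triangulations:
one boundary vertex is added for each index, and the dominant sets with as many elements as there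
are indices play the role of maximal simplices. Each of their facets lies in exactly two of them
(`isDominant_insert_iff`), except that the facets made of boundary vertices only lie in exactly one.
Counting the facets that carry all colours but one, the number of rainbow dominant sets is odd
(`card_rainbow_modEq`, `exists_rainbow_isDominant`).
-/

/-! ### Parity of rainbow sets -/

open Classical in
/-- A single set `S` with as many elements as there are colours has an odd number of facets
coloured by exactly the colours other than `i₀` if and only if `S` itself is rainbow. -/
theorem card_facets_modEq {X I : Type*} [Fintype I] (S : Finset X)
    (hS : S.card = Fintype.card I) (c : X → I) (i₀ : I) :
    (S.filter fun x => (S.erase x).image c = Finset.univ.erase i₀).card ≡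
      (if S.image c = Finset.univ then 1 else 0) [MOD 2] := by
  split_ifs with h
  · have hinj : Set.InjOn c S := by
      apply Finset.card_image_iff.mp
      rw [h, Finset.card_univ, hS]
    obtain ⟨x, hx, rfl⟩ : ∃ x ∈ S, c x = i₀ := by
      simpa using (Finset.ext_iff.mp h i₀).mpr (Finset.mem_univ _)
    have : (S.filter fun z => (S.erase z).image c = Finset.univ.erase (c x)) = {x} := by
      ext z
      simp only [Finset.mem_filter, Finset.mem_singleton]
      constructor
      · rintro ⟨hz, hzc⟩
        by_contra hne
        have : c x ∈ (S.erase z).image c :=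
          Finset.mem_image_of_mem c (Finset.mem_erase.mpr ⟨fun e => hne e.symm, hx⟩)
        rw [hzc] at this
        simp at this
      · rintro rfl
        refine ⟨hx, ?_⟩
        ext i
        simp only [Finset.mem_image, Finset.mem_erase, Finset.mem_univ, and_true]
        constructor
        · rintro ⟨w, ⟨hw, hwS⟩, rfl⟩ e
          exact hw (hinj hwS hx e)
        · intro hi
          obtain ⟨w, hw, rfl⟩ : ∃ w ∈ S, c w = i := by
            simpa using (Finset.ext_iff.mp h i).mpr (Finset.mem_univ _)
          exact ⟨w, ⟨fun e => hi (by rw [e]), hw⟩, rfl⟩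
    rw [this, Finset.card_singleton]
  · by_cases hex : ∃ x ∈ S, (S.erase x).image c = Finset.univ.erase i₀
    · obtain ⟨x, hx, hxc⟩ := hex
      have hcx : c x ≠ i₀ := by
        intro e
        apply h
        rw [← Finset.insert_erase hx, Finset.image_insert, hxc, e,
          Finset.insert_erase (Finset.mem_univ _)]
      obtain ⟨x', hx', hxx'⟩ : ∃ x' ∈ S.erase x, c x' = c x := by
        have : c x ∈ (S.erase x).image c := by rw [hxc]; simp [hcx]
        simpa using this
      have hinj : Set.InjOn c (S.erase x : Finset X) := by
        apply Finset.card_image_iff.mp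
        rw [hxc, Finset.card_erase_of_mem hx, hS, Finset.card_erase_of_mem (Finset.mem_univ _),
          Finset.card_univ]
      have hne : x' ≠ x := (Finset.mem_erase.mp hx').1
      have hx'S : x' ∈ S := (Finset.mem_erase.mp hx').2
      have : (S.filter fun z => (S.erase z).image c = Finset.univ.erase i₀) = {x, x'} := by
        ext z
        simp only [Finset.mem_filter, Finset.mem_insert, Finset.mem_singleton]
        constructor
        · rintro ⟨hz, hzc⟩
          by_contra! hcon
          have : c z ∈ (S.erase z).image c := by
            rw [hzc, ← hxc]
            exact Finset.mem_image_of_mem c (Finset.mem_erase.mpr ⟨hcon.1, hz⟩)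
          obtain ⟨w, hw, hwz⟩ := Finset.mem_image.mp this
          obtain ⟨hw1, hw2⟩ := Finset.mem_erase.mp hw
          by_cases hwx : w = x
          · subst hwx
            exact hcon.2 (hinj (by simp [hcon.1, hz]) (Finset.mem_coe.mpr hx')
              (by rw [← hwz, hxx']))
          · exact hw1 (hinj (by simp [hwx, hw2]) (by simp [hcon.1, hz]) hwz)
        · rintro (rfl | rfl)
          · exact ⟨hx, hxc⟩
          · refine ⟨hx'S, ?_⟩
            rw [← hxc]
            ext i
            simp only [Finset.mem_image, Finset.mem_erase]
            constructor
            · rintro ⟨w, ⟨hw, hwS⟩, rfl⟩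
              by_cases hwx : w = x
              · exact ⟨z, ⟨hne, hx'S⟩, by rw [hxx', hwx]⟩
              · exact ⟨w, ⟨hwx, hwS⟩, rfl⟩
            · rintro ⟨w, ⟨hw, hwS⟩, rfl⟩
              by_cases hwx : w = z
              · exact ⟨x, ⟨hne.symm, hx⟩, by rw [hwx, hxx']⟩
              · exact ⟨w, ⟨hwx, hwS⟩, rfl⟩
      rw [this, Finset.card_pair hne.symm]
      rfl
    · push Not at hex
      rw [Finset.filter_false_of_mem hex]
      rfl

open Classical in
/-- Double counting of the incidences between the members of `F` and their facets coloured by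
exactly the colours other than `i₀`. -/
theorem card_rainbow_modEq {X I : Type*} [Fintype X] [Fintype I] (F : Finset (Finset X))
    (hF : ∀ S ∈ F, S.card = Fintype.card I) (c : X → I) (i₀ : I) :
    (F.filter fun S => S.image c = Finset.univ).card ≡
      ∑ τ ∈ Finset.univ.filter (fun τ : Finset X =>
          τ.image c = Finset.univ.erase i₀ ∧ τ.card + 1 = Fintype.card I),
        (Finset.univ.filter fun y => y ∉ τ ∧ insert y τ ∈ F).card [MOD 2] := by
  rw [← Finset.card_sigma]
  have hbij : (F.sigma fun S => S.filter fun x =>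
      (S.erase x).image c = Finset.univ.erase i₀).card =
      ((Finset.univ.filter (fun τ : Finset X =>
          τ.image c = Finset.univ.erase i₀ ∧ τ.card + 1 = Fintype.card I)).sigma fun τ =>
        Finset.univ.filter fun y => y ∉ τ ∧ insert y τ ∈ F).card := by
    refine Finset.card_bij' (fun p _ => ⟨p.1.erase p.2, p.2⟩) (fun p _ => ⟨insert p.2 p.1, p.2⟩)
      ?_ ?_ ?_ ?_
    · rintro ⟨S, x⟩ h
      simp only [Finset.mem_sigma, Finset.mem_filter] at h
      have hpos := Finset.card_pos.mpr ⟨x, h.2.1⟩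
      have := hF S h.1
      simp only [Finset.mem_sigma, Finset.mem_filter, Finset.mem_univ, true_and,
        Finset.insert_erase h.2.1, Finset.card_erase_of_mem h.2.1]
      refine ⟨⟨h.2.2, by omega⟩, by simp, h.1⟩
    · rintro ⟨τ, y⟩ h
      simp only [Finset.mem_sigma, Finset.mem_filter, Finset.mem_univ, true_and] at h
      simp only [Finset.mem_sigma, Finset.mem_filter, Finset.erase_insert h.2.1]
      exact ⟨h.2.2, Finset.mem_insert_self _ _, h.1.1⟩
    · rintro ⟨S, x⟩ h
      simp only [Finset.mem_sigma, Finset.mem_filter] at h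
      simp [Finset.insert_erase h.2.1]
    · rintro ⟨τ, y⟩ h
      simp only [Finset.mem_sigma, Finset.mem_filter, Finset.mem_univ, true_and] at h
      simp [Finset.erase_insert h.2.1]
  rw [← hbij, Finset.card_sigma, Finset.card_filter]
  exact (Nat.ModEq.sum fun S hS => card_facets_modEq S (hF S hS) c i₀).symm

/-! ### Dominant sets -/

/-- The set `S` is dominant for the family of rankings `r` if no point `y` ranks strictly above
the `r i`-lowest element of `S` for every `i` simultaneously. -/
def IsDominant {X I : Type*} (r : I → X → ℕ) (S : Finset X) : Prop :=
  ∀ y, ∃ i, ∀ x ∈ S, r i y ≤ r i x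

theorem IsDominant.mono {X I : Type*} {r : I → X → ℕ} {S τ : Finset X} (h : IsDominant r S)
    (hτ : τ ⊆ S) : IsDominant r τ := fun y =>
  let ⟨i, hi⟩ := h y
  ⟨i, fun x hx => hi x (hτ hx)⟩

/-- A point `y` can be added to a dominant facet `τ`, in place of one of the two indices `l` at
which `m` (the choice of the `r l`-lowest element of `τ`) fails to be injective, if it ranks above
`m k` for all `k ≠ l` and is `r l`-highest among such points. -/
def IsExchange {X I : Type*} (r : I → X → ℕ) (m : I → X) (l : I) (y : X) : Prop :=
  (∀ k, k ≠ l → r k (m k) < r k y) ∧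
    ∀ z, (∀ k, k ≠ l → r k (m k) < r k z) → r l z ≤ r l y

theorem IsExchange.unique {X I : Type*} {r : I → X → ℕ} (hr : ∀ i, Function.Injective (r i))
    {m : I → X} {l : I} {y z : X} (hy : IsExchange r m l y) (hz : IsExchange r m l z) : y = z :=
  hr l (le_antisymm (hz.2 y hy.1) (hy.2 z hz.1))

theorem exists_isExchange {X I : Type*} [Finite X] (r : I → X → ℕ) (m : I → X) (l : I) {z : X}
    (hz : ∀ k, k ≠ l → r k (m k) < r k z) : ∃ y, IsExchange r m l y := by
  obtain ⟨y, hy, hmax⟩ := Set.exists_max_image {y | ∀ k, k ≠ l → r k (m k) < r k y} (r l)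
    (Set.toFinite _) ⟨z, hz⟩
  exact ⟨y, hy, hmax⟩

/-- The hypotheses say that `m` picks the `r l`-lowest element of the dominant set `τ`, that `τ`
has one element fewer than there are indices, so `m` identifies exactly one pair `i ≠ j`. An added
point `y` becomes lowest at a single index, and every element of `τ` must stay lowest at some other
index, so `y` can only take over `i` or `j`. -/
theorem isDominant_insert_iff {X I : Type*} [Fintype I] [DecidableEq X] {r : I → X → ℕ}
    (hr : ∀ i, Function.Injective (r i)) {τ : Finset X} (hτ : IsDominant r τ)
    (hcard : τ.card + 1 = Fintype.card I) {m : I → X} (hmem : ∀ l, m l ∈ τ)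
    (hmin : ∀ l, ∀ x ∈ τ, r l (m l) ≤ r l x) {i j : I} (hij : i ≠ j) (hmij : m i = m j) (y : X) :
    (y ∉ τ ∧ IsDominant r (insert y τ)) ↔ IsExchange r m i y ∨ IsExchange r m j y := by
  classical
  have hsurj : ∀ x ∈ τ, ∃ l, m l = x := by
    intro x hx
    obtain ⟨l, hl⟩ := hτ x
    exact ⟨l, hr l (le_antisymm (hmin l x hx) (hl _ (hmem l)))⟩
  have key : ∀ i j : I, i ≠ j → m i = m j →
      (∀ x ∈ τ, ∃ l, l ≠ i ∧ m l = x) ∧ ∀ a b, a ≠ i → b ≠ i → m a = m b → a = b := by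
    intro i j hij hmij
    have h1 : ∀ x ∈ τ, ∃ l, l ≠ i ∧ m l = x := by
      intro x hx
      obtain ⟨l, hl⟩ := hsurj x hx
      by_cases e : l = i
      · exact ⟨j, hij.symm, by rw [← hl, e, hmij]⟩
      · exact ⟨l, e, hl⟩
    refine ⟨h1, fun a b ha hb hab => ?_⟩
    have hs : Set.SurjOn m (Finset.univ.erase i : Finset I) τ := by
      intro x hx
      obtain ⟨l, hl, hlx⟩ := h1 x hx
      exact ⟨l, by simpa using hl, hlx⟩
    refine Finset.injOn_of_surjOn_of_card_le m (fun l _ => hmem l) hs ?_ (by simpa using ha)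
      (by simpa using hb) hab
    rw [Finset.card_erase_of_mem (Finset.mem_univ _), Finset.card_univ]
    omega
  obtain ⟨hsi, hii⟩ := key i j hij hmij
  obtain ⟨hsj, hij'⟩ := key j i hij.symm hmij.symm
  constructor
  · rintro ⟨hy, hdom⟩
    obtain ⟨l, hl⟩ := hdom y
    have hp : ∀ t ∈ τ, ∃ k, k ≠ l ∧ m k = t ∧ r k t < r k y := by
      intro t ht
      obtain ⟨k, hk⟩ := hdom t
      have hty : t ≠ y := fun e => hy (e ▸ ht)
      have hlt : r k t < r k y :=
        lt_of_le_of_ne (hk y (Finset.mem_insert_self _ _)) fun e => hty (hr k e)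
      refine ⟨k, ?_, ?_, hlt⟩
      · rintro rfl
        exact absurd (hl t (Finset.mem_insert_of_mem ht)) (not_le.mpr hlt)
      · exact hr k (le_antisymm (hmin k t ht) (hk _ (Finset.mem_insert_of_mem (hmem k))))
    have hlij : l = i ∨ l = j := by
      by_contra! hcon
      obtain ⟨k, hkl, hk, -⟩ := hp (m l) (hmem l)
      by_cases hki : k = i
      · exact hkl (hij' k l (by rw [hki]; exact hij) hcon.2 hk)
      · exact hkl (hii k l hki hcon.1 hk)
    have hlex : IsExchange r m l y := by
      constructor
      · intro k hk
        obtain ⟨k', hk'l, hk', hlt⟩ := hp (m k) (hmem k)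
        have : k' = k := by
          rcases hlij with rfl | rfl
          · exact hii _ _ hk'l hk hk'
          · exact hij' _ _ hk'l hk hk'
        rwa [this] at hlt
      · intro z hz
        obtain ⟨k, hk⟩ := hdom z
        by_cases hkl : k = l
        · subst hkl
          exact hk y (Finset.mem_insert_self _ _)
        · exact absurd (hk _ (Finset.mem_insert_of_mem (hmem k))) (not_le.mpr (hz k hkl))
    rcases hlij with rfl | rfl
    · exact Or.inl hlex
    · exact Or.inr hlex
  · have main : ∀ l, (∀ x ∈ τ, ∃ k, k ≠ l ∧ m k = x) → IsExchange r m l y →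
        y ∉ τ ∧ IsDominant r (insert y τ) := by
      intro l hs hex
      constructor
      · intro hy
        obtain ⟨k, hk, rfl⟩ := hs y hy
        exact lt_irrefl _ (hex.1 k hk)
      · intro z
        by_cases hz : ∀ k, k ≠ l → r k (m k) < r k z
        · refine ⟨l, fun x hx => ?_⟩
          rcases Finset.mem_insert.mp hx with rfl | hx
          · exact hex.2 z hz
          · obtain ⟨k, hk⟩ := hτ z
            by_cases hkl : k = l
            · subst hkl
              exact hk x hx
            · exact absurd (hk _ (hmem k)) (not_le.mpr (hz k hkl))
        · push Not at hz
          obtain ⟨k, hkl, hk⟩ := hz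
          refine ⟨k, fun x hx => ?_⟩
          rcases Finset.mem_insert.mp hx with rfl | hx
          · exact hk.trans (hex.1 k hkl).le
          · exact hk.trans (hmin k x hx)
    rintro (h | h)
    · exact main i hsi h
    · exact main j hsj h

/-- The two exchanges of a dominant set lead to different points. -/
theorem IsExchange.ne {X I : Type*} {r : I → X → ℕ} {τ : Finset X} (hτ : IsDominant r τ)
    {m : I → X} (hmem : ∀ l, m l ∈ τ) {i j : I} (hij : i ≠ j) {y z : X}
    (hy : IsExchange r m i y) (hz : IsExchange r m j z) : y ≠ z := by
  rintro rfl
  obtain ⟨k, hk⟩ := hτ y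
  have := hk _ (hmem k)
  by_cases hki : k = i
  · exact absurd this (not_le.mpr (hz.1 k (by rw [hki]; exact hij)))
  · exact absurd this (not_le.mpr (hy.1 k hki))

/-- Every nonempty finite set has an `r l`-lowest element for each `l`, and on a set with one
element fewer than there are indices two of these coincide. -/
theorem exists_lowest_and_collision {X I : Type*} [Fintype I] (r : I → X → ℕ) {τ : Finset X}
    (hne : τ.Nonempty) (hcard : τ.card + 1 = Fintype.card I) :
    ∃ m : I → X, (∀ l, m l ∈ τ) ∧ (∀ l, ∀ x ∈ τ, r l (m l) ≤ r l x) ∧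
      ∃ i j, i ≠ j ∧ m i = m j := by
  choose m hmem hmin using fun l => τ.exists_min_image (r l) hne
  obtain ⟨i, -, j, -, hij, h⟩ := Finset.exists_ne_map_eq_of_card_lt_of_maps_to
    (s := Finset.univ) (t := τ) (f := m) (by rw [Finset.card_univ]; omega) (fun l _ => hmem l)
  exact ⟨m, hmem, hmin, i, j, hij, h⟩

/-! ### Scarf's lemma -/

open Classical in
/-- Scarf's lemma with boundary vertices: `b i` ranks lowest for `r i`, and for `r j` with
`j ≠ i` it ranks above all points that are not boundary vertices. -/
theorem exists_rainbow_isDominant {X I : Type*} [Fintype X] [Fintype I] [Nontrivial I]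
    (r : I → X → ℕ) (hr : ∀ i, Function.Injective (r i)) (b : I → X)
    (hlow : ∀ i x, r i (b i) ≤ r i x)
    (hhigh : ∀ x, x ∉ Set.range b → ∀ i j, j ≠ i → r i x < r i (b j))
    (x₀ : X) (hx₀ : x₀ ∉ Set.range b) (c : X → I) (hc : ∀ i, c (b i) = i) :
    ∃ S : Finset X, S.card = Fintype.card I ∧ IsDominant r S ∧ S.image c = Finset.univ := by
  obtain ⟨i₀⟩ : Nonempty I := inferInstance
  set F : Finset (Finset X) :=
    Finset.univ.filter fun S => S.card = Fintype.card I ∧ IsDominant r S with hFdef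
  have hpar := card_rainbow_modEq F (fun S hS => (Finset.mem_filter.mp hS).2.1) c i₀
  have hn : 1 < Fintype.card I := Fintype.one_lt_card
  have hbinj : Function.Injective b := fun i j h => by rw [← hc i, h, hc j]
  set τ₀ : Finset X := (Finset.univ.erase i₀).image b with hτ₀
  have hτ₀card : τ₀.card + 1 = Fintype.card I := by
    rw [hτ₀, Finset.card_image_of_injective _ hbinj, Finset.card_erase_of_mem (Finset.mem_univ _),
      Finset.card_univ]
    omega
  have hτ₀mem : ∀ k, k ≠ i₀ → b k ∈ τ₀ := fun k hk =>
    Finset.mem_image_of_mem b (by simpa using hk)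
  have hdeg : ∀ τ : Finset X, τ.card + 1 = Fintype.card I →
      (Finset.univ.filter fun y => y ∉ τ ∧ insert y τ ∈ F) =
        Finset.univ.filter fun y => y ∉ τ ∧ IsDominant r (insert y τ) := by
    intro τ hτ
    refine Finset.filter_congr fun y _ => and_congr_right fun hy => ?_
    rw [hFdef, Finset.mem_filter, Finset.card_insert_of_notMem hy]
    simp [hτ]
  have hother : ∀ τ : Finset X, τ.image c = Finset.univ.erase i₀ →
      τ.card + 1 = Fintype.card I → τ ≠ τ₀ →
      (Finset.univ.filter fun y => y ∉ τ ∧ insert y τ ∈ F).card ≡ 0 [MOD 2] := by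
    intro τ hτc hcard hne
    rw [hdeg τ hcard]
    by_cases hdom : IsDominant r τ
    · obtain ⟨t, ht, htb⟩ : ∃ t ∈ τ, t ∉ Set.range b := by
        by_contra! hcon
        apply hne
        refine Finset.eq_of_subset_of_card_le (fun x hx => ?_) (by omega)
        obtain ⟨k, rfl⟩ := hcon x hx
        refine hτ₀mem k ?_
        have := Finset.mem_image_of_mem c hx
        rw [hτc, hc] at this
        simpa using this
      obtain ⟨m, hmem, hmin, i, j, hij, hmij⟩ :=
        exists_lowest_and_collision r ⟨t, ht⟩ hcard
      have hex : ∀ l, ∃ y, IsExchange r m l y := fun l =>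
        exists_isExchange r m l (z := b l) fun k hk =>
          (hmin k t ht).trans_lt (hhigh t htb k l hk.symm)
      obtain ⟨y, hy⟩ := hex i
      obtain ⟨z, hz⟩ := hex j
      have : (Finset.univ.filter fun y => y ∉ τ ∧ IsDominant r (insert y τ)) = {y, z} := by
        ext w
        simp only [Finset.mem_filter, Finset.mem_univ, true_and, Finset.mem_insert,
          Finset.mem_singleton,
          isDominant_insert_iff hr hdom hcard hmem hmin hij hmij w]
        constructor
        · rintro (h | h)
          · exact Or.inl (h.unique hr hy)
          · exact Or.inr (h.unique hr hz)
        · rintro (rfl | rfl)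
          · exact Or.inl hy
          · exact Or.inr hz
      rw [this, Finset.card_pair (hy.ne hdom hmem hij hz)]
      rfl
    · rw [Finset.filter_false_of_mem fun y _ h => hdom (h.2.mono (Finset.subset_insert _ _))]
      rfl
  have hbase : (Finset.univ.filter fun y => y ∉ τ₀ ∧ insert y τ₀ ∈ F).card = 1 := by
    rw [hdeg τ₀ hτ₀card]
    have hτ₀ne : τ₀.Nonempty := Finset.card_pos.mp (by omega)
    have hdom : IsDominant r τ₀ := by
      intro y
      by_cases hy : y ∈ Set.range b
      · obtain ⟨k, rfl⟩ := hy
        exact ⟨k, fun x _ => hlow k x⟩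
      · refine ⟨i₀, fun x hx => ?_⟩
        obtain ⟨k, hk, rfl⟩ := Finset.mem_image.mp hx
        exact (hhigh y hy i₀ k (Finset.mem_erase.mp hk).1).le
    obtain ⟨m, hmem, hmin, -⟩ := exists_lowest_and_collision r hτ₀ne hτ₀card
    have hm : ∀ k, k ≠ i₀ → m k = b k := fun k hk =>
      hr k (le_antisymm (hmin k _ (hτ₀mem k hk)) (hlow k _))
    obtain ⟨j, hj, hmj⟩ := Finset.mem_image.mp (hmem i₀)
    have hj : j ≠ i₀ := (Finset.mem_erase.mp hj).1
    obtain ⟨y, hy⟩ := exists_isExchange r m i₀ (z := x₀) fun k hk => by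
      rw [hm k hk]
      exact lt_of_le_of_ne (hlow k x₀) fun e => hx₀ ⟨k, hr k e⟩
    have hno : ∀ z, ¬ IsExchange r m j z := by
      rintro z ⟨hz, -⟩
      have h0 := hz i₀ hj.symm
      rw [← hmj] at h0
      by_cases hzb : z ∈ Set.range b
      · obtain ⟨k, rfl⟩ := hzb
        by_cases hk0 : k = i₀
        · subst hk0
          exact absurd (hlow k (b j)) (not_le.mpr h0)
        · by_cases hkj : k = j
          · subst hkj
            exact lt_irrefl _ h0
          · have := hz k hkj
            rw [hm k hk0] at this
            exact lt_irrefl _ this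
      · exact absurd (hhigh z hzb i₀ j hj) (not_lt.mpr h0.le)
    have : (Finset.univ.filter fun y => y ∉ τ₀ ∧ IsDominant r (insert y τ₀)) = {y} := by
      ext w
      simp only [Finset.mem_filter, Finset.mem_univ, true_and, Finset.mem_singleton,
        isDominant_insert_iff hr hdom hτ₀card hmem hmin hj.symm (by rw [hm j hj, hmj]) w]
      constructor
      · rintro (h | h)
        · exact h.unique hr hy
        · exact absurd h (hno w)
      · rintro rfl
        exact Or.inl hy
    rw [this, Finset.card_singleton]
  have hτ₀D : τ₀ ∈ Finset.univ.filter (fun τ : Finset X =>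
      τ.image c = Finset.univ.erase i₀ ∧ τ.card + 1 = Fintype.card I) := by
    refine Finset.mem_filter.mpr ⟨Finset.mem_univ _, ?_, hτ₀card⟩
    rw [hτ₀, Finset.image_image, show c ∘ b = id from funext hc, Finset.image_id]
  have hsum : (F.filter fun S => S.image c = Finset.univ).card ≡ 1 [MOD 2] := by
    refine hpar.trans ?_
    rw [← Finset.add_sum_erase _ _ hτ₀D, hbase]
    refine (Nat.ModEq.refl 1).add (c := _) (d := 0) ?_
    refine (Nat.ModEq.sum (g := fun _ => 0) fun τ hτ => ?_).trans (by simp; rfl)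
    obtain ⟨hne, hτ⟩ := Finset.mem_erase.mp hτ
    obtain ⟨-, h1, h2⟩ := Finset.mem_filter.mp hτ
    exact hother τ h1 h2 hne
  have hpos : 0 < (F.filter fun S => S.image c = Finset.univ).card := by
    rcases Nat.eq_zero_or_pos (F.filter fun S => S.image c = Finset.univ).card with h | h
    · rw [h] at hsum
      exact absurd hsum (by decide)
    · exact h
  obtain ⟨S, hS⟩ := Finset.card_pos.mp hpos
  obtain ⟨hS1, hS2⟩ := Finset.mem_filter.mp hS
  obtain ⟨-, hS3, hS4⟩ := Finset.mem_filter.mp hS1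
  exact ⟨S, hS3, hS4, hS2⟩

/-- Scarf's lemma: for any colouring `c` of a finite set `T` by the indices of a family `g` of
(not necessarily injective) rankings of `T`, some nonempty `σ ⊆ T` is dominant with respect to
just those rankings whose indices are the colours of its elements. -/
theorem exists_dominant_colours {T I : Type*} [Fintype T] [Nonempty T] [Fintype I] [Nontrivial I]
    (g : I → T → ℕ) (c : T → I) :
    ∃ σ : Finset T, σ.Nonempty ∧
      ∀ y, ∃ i ∈ c '' σ, ∀ x ∈ σ, g i y ≤ g i x := by
  classical
  -- Ties in `g` are broken by an enumeration `e` of `T`.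
  let e := Fintype.equivFin T
  let e' := Fintype.equivFin I
  let N := Fintype.card T
  have hg : ∀ i a a', N * g i a + e a ≤ N * g i a' + e a' → g i a ≤ g i a' := by
    intro i a a' h
    by_contra! hlt
    have h1 := (e a').isLt
    have : N * (g i a' + 1) ≤ N * g i a := Nat.mul_le_mul_left _ hlt
    rw [Nat.mul_add] at this
    change _ < N at h1
    omega
  obtain ⟨B, hB⟩ : ∃ B, ∀ i a, N * g i a + e a < B := by
    obtain ⟨B, hB⟩ := (Set.finite_range fun p : I × T => N * g p.1 p.2 + e p.2).bddAbove
    exact ⟨B + 1, fun i a => Nat.lt_succ_of_le (hB ⟨(i, a), rfl⟩)⟩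
  -- The vertex `inr i` ranks lowest for `i` and above all of `T` for every other index.
  let r : I → T ⊕ I → ℕ := fun i => Sum.elim (fun a => N * g i a + e a + 1)
    (fun j => if j = i then 0 else B + 1 + e' j)
  have hrl : ∀ i a, r i (Sum.inl a) = N * g i a + e a + 1 := fun _ _ => rfl
  have hrr : ∀ i j, r i (Sum.inr j) = if j = i then 0 else B + 1 + e' j := fun _ _ => rfl
  have hr : ∀ i, Function.Injective (r i) := by
    intro i
    rintro (a | j) (a' | j') h
    · rw [hrl, hrl] at h
      have h1 := hg i a a' (by omega)
      have h2 := hg i a' a (by omega)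
      have h3 : g i a = g i a' := le_antisymm h1 h2
      rw [h3] at h
      have : e a = e a' := Fin.ext (by omega)
      rw [e.injective this]
    · rw [hrl, hrr] at h
      have := hB i a
      split_ifs at h
      omega
    · rw [hrl, hrr] at h
      have := hB i a'
      split_ifs at h
      omega
    · rw [hrr, hrr] at h
      split_ifs at h with h1 h2 h2
      · rw [h1, h2]
      · omega
      · omega
      · have : e' j = e' j' := Fin.ext (by omega)
        rw [e'.injective this]
  obtain ⟨S, hcard, hdom, hrain⟩ := exists_rainbow_isDominant r hr Sum.inr
    (fun i x => by simp [hrr])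
    (by
      rintro (a | k) hx i j hji
      · rw [hrl, hrr, if_neg hji]
        have := hB i a
        omega
      · exact absurd ⟨k, rfl⟩ hx)
    (Sum.inl (Classical.arbitrary T)) (by simp) (Sum.elim c id) (fun i => rfl)
  have hdom' : ∀ y, ∃ i ∈ c '' (S.preimage Sum.inl Sum.inl_injective.injOn : Finset T),
      ∀ x ∈ S.preimage Sum.inl Sum.inl_injective.injOn, g i y ≤ g i x := by
    intro y
    obtain ⟨i, hi⟩ := hdom (Sum.inl y)
    refine ⟨i, ?_, fun x hx => ?_⟩
    · obtain ⟨s, hs, hsi⟩ : ∃ s ∈ S, Sum.elim c id s = i := by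
        simpa using (Finset.ext_iff.mp hrain i).mpr (Finset.mem_univ _)
      rcases s with a | k
      · exact ⟨a, by simpa using hs, hsi⟩
      · obtain rfl : k = i := hsi
        have := hi _ hs
        rw [hrl, hrr, if_pos rfl] at this
        omega
    · have := hi _ (Finset.mem_preimage.mp hx)
      rw [hrl, hrl] at this
      exact hg i y x (by omega)
  refine ⟨_, ?_, hdom'⟩
  obtain ⟨i, ⟨a, ha, -⟩, -⟩ := hdom' (Classical.arbitrary T)
  exact ⟨a, ha⟩

/-! ### Brouwer's theorem for the standard simplex -/

/-- If no point of the grid `∑ i, y i = k` exceeds the minima over `σ` in all coordinates from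
`C`, then the points of `σ` are close to each other and their coordinates outside `C` are small. -/
theorem grid_close_of_dominant {ι : Type*} [Fintype ι] [Nonempty ι] {k : ℕ} {σ : Finset (ι → ℕ)}
    (hσ : ∀ a ∈ σ, ∑ i, a i = k) (C : Set ι)
    (hdom : ∀ y : ι → ℕ, ∑ i, y i = k → ∃ i ∈ C, ∀ x ∈ σ, y i ≤ x i)
    {a : ι → ℕ} (ha : a ∈ σ) (i : ι) :
    (∀ a' ∈ σ, a i ≤ a' i + Fintype.card ι) ∧ (i ∉ C → a i ≤ Fintype.card ι) := by
  classical
  choose m hmem hmin using fun i => σ.exists_min_image (fun x => x i) ⟨a, ha⟩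
  let μ : ι → ℕ := fun i => if i ∈ C then m i i + 1 else 0
  have hμC : ∀ i ∈ C, μ i = m i i + 1 := fun i hi => if_pos hi
  have hμle : ∀ j, ∀ a' ∈ σ, μ j ≤ a' j + 1 := by
    intro j a' ha'
    have := hmin j a' ha'
    dsimp only [μ]
    split_ifs <;> omega
  have hlt : k < ∑ j, μ j := by
    by_contra! hle
    obtain ⟨i₁⟩ : Nonempty ι := inferInstance
    obtain ⟨j, hj, hjle⟩ := hdom (fun j => μ j + if j = i₁ then k - ∑ j, μ j else 0) (by
      rw [Finset.sum_add_distrib, Finset.sum_ite_eq' Finset.univ i₁, if_pos (Finset.mem_univ _)]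
      omega)
    have := hjle _ (hmem j)
    rw [hμC j hj] at this
    omega
  have hai : a i ≤ μ i + Fintype.card ι - 1 := by
    have h1 : ∑ j ∈ Finset.univ.erase i, μ j ≤ ∑ j ∈ Finset.univ.erase i, (a j + 1) :=
      Finset.sum_le_sum fun j _ => hμle j a ha
    rw [Finset.sum_add_distrib, Finset.sum_const, smul_eq_mul, mul_one,
      Finset.card_erase_of_mem (Finset.mem_univ _), Finset.card_univ] at h1
    have h2 := Finset.add_sum_erase Finset.univ μ (Finset.mem_univ i)
    have h3 := Finset.add_sum_erase Finset.univ a (Finset.mem_univ i)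
    have h4 := hσ a ha
    omega
  refine ⟨fun a' ha' => ?_, fun hi => ?_⟩
  · have := hμle i a' ha'
    omega
  · have : μ i = 0 := if_neg hi
    omega

/-- Approximate fixed points: any self-map of the standard simplex, continuous or not, has near
some point `p`, for every coordinate `i`, a point at which it almost does not decrease `i`. -/
theorem exists_approx_fixedPoint {ι : Type*} [Fintype ι] [Nontrivial ι]
    (f : stdSimplex ℝ ι → stdSimplex ℝ ι) {k : ℕ} (hk : 0 < k) :
    ∃ p : stdSimplex ℝ ι, ∀ i, ∃ q : stdSimplex ℝ ι,
      dist q p ≤ Fintype.card ι / k ∧ q i ≤ f q i + Fintype.card ι / k := by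
  classical
  have hk' : (0 : ℝ) < k := by exact_mod_cast hk
  let T := ↥(Finset.piAntidiag (Finset.univ : Finset ι) k)
  have hT : ∀ a : T, ∑ i, a.1 i = k := fun a => (Finset.mem_piAntidiag.mp a.2).1
  obtain ⟨i₁⟩ : Nonempty ι := inferInstance
  have : Nonempty T := ⟨⟨Pi.single i₁ k, by simp⟩⟩
  let P : T → stdSimplex ℝ ι := fun a => ⟨fun i => a.1 i / k, fun i => by positivity, by
    rw [← Finset.sum_div, ← Nat.cast_sum, hT a, div_self hk'.ne']⟩
  have hP : ∀ a i, P a i = a.1 i / k := fun _ _ => rfl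
  have hcol : ∀ a : T, ∃ i, P a i ≤ f (P a) i := by
    intro a
    obtain ⟨i, -, hi⟩ := Finset.exists_le_of_sum_le (s := Finset.univ) Finset.univ_nonempty
      (f := P a) (g := f (P a)) (by rw [stdSimplex.sum_eq_one, stdSimplex.sum_eq_one])
    exact ⟨i, hi⟩
  choose c hc using hcol
  obtain ⟨σ, ⟨a, ha⟩, hdom⟩ := exists_dominant_colours (fun i (a : T) => a.1 i) c
  have hclose := fun (b : T) (hb : b ∈ σ) (i : ι) =>
    grid_close_of_dominant (σ := σ.image Subtype.val) (k := k)
      (by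
        intro a ha
        obtain ⟨b, -, rfl⟩ := Finset.mem_image.mp ha
        exact hT b)
      (c '' σ)
      (by
        intro y hy
        obtain ⟨i, hi, h⟩ := hdom ⟨y, by simp [hy]⟩
        refine ⟨i, hi, fun x hx => ?_⟩
        obtain ⟨b, hb, rfl⟩ := Finset.mem_image.mp hx
        exact h b hb)
      (Finset.mem_image_of_mem _ hb) i
  have hle : ∀ b ∈ σ, ∀ b' ∈ σ, ∀ i, P b i - P b' i ≤ Fintype.card ι / k := by
    intro b hb b' hb' i
    have h := (hclose b hb i).1 _ (Finset.mem_image_of_mem _ hb')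
    rw [hP, hP, ← sub_div]
    gcongr
    rw [sub_le_iff_le_add']
    exact_mod_cast h
  have hpos : (0 : ℝ) ≤ Fintype.card ι / k := by positivity
  refine ⟨P a, fun i => ?_⟩
  by_cases hi : i ∈ c '' σ
  · obtain ⟨b, hb, rfl⟩ := hi
    refine ⟨P b, ?_, (hc b).trans (by linarith)⟩
    rw [Subtype.dist_eq, dist_pi_le_iff hpos]
    intro j
    rw [Real.dist_eq, abs_le]
    have h1 := hle b hb a ha j
    have h2 := hle a ha b hb j
    exact ⟨by linarith [show (P b).1 j = P b j from rfl, show (P a).1 j = P a j from rfl], h1⟩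
  · refine ⟨P a, by rw [dist_self]; exact hpos, ?_⟩
    have h := (hclose a ha i).2 hi
    have h1 : P a i ≤ Fintype.card ι / k := by
      rw [hP]
      gcongr
    linarith [stdSimplex.zero_le (f (P a)) i]

/-- **Brouwer's fixed point theorem** for the standard simplex. -/
theorem exists_fixedPoint_stdSimplex {ι : Type*} [Fintype ι] [Nonempty ι]
    (f : stdSimplex ℝ ι → stdSimplex ℝ ι) (hf : Continuous f) : ∃ x, f x = x := by
  classical
  rcases subsingleton_or_nontrivial ι with hι | hι
  · obtain ⟨i⟩ : Nonempty ι := inferInstance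
    have hsub : ∀ x y : stdSimplex ℝ ι, x = y := by
      intro x y
      have hone : ∀ (z : stdSimplex ℝ ι) (j : ι), z j = 1 := fun z j => by
        rw [← Fintype.sum_subsingleton z j, stdSimplex.sum_eq_one]
      exact stdSimplex.ext (funext fun j => (hone x j).trans (hone y j).symm)
    exact ⟨⟨_, single_mem_stdSimplex ℝ i⟩, hsub _ _⟩
  choose p q hqp hq using fun k : ℕ => exists_approx_fixedPoint f k.succ_pos
  obtain ⟨x, φ, hφ, hx⟩ := CompactSpace.tendsto_subseq p
  have hε : Filter.Tendsto (fun k => (Fintype.card ι : ℝ) / ((φ k).succ : ℕ)) Filter.atTop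
      (nhds 0) := by
    have := (tendsto_const_div_atTop_nhds_zero_nat (Fintype.card ι : ℝ)).comp
      ((Filter.tendsto_add_atTop_nat 1).comp hφ.tendsto_atTop)
    exact this
  have hqx : ∀ i, Filter.Tendsto (fun k => q (φ k) i) Filter.atTop (nhds x) := fun i =>
    tendsto_of_tendsto_of_dist hx (squeeze_zero (fun _ => dist_nonneg)
      (fun k => by rw [dist_comm]; exact hqp (φ k) i) hε)
  have hcoord : ∀ i, Continuous fun z : stdSimplex ℝ ι => z i := fun i =>
    (continuous_apply i).comp continuous_subtype_val
  have hle : ∀ i, x i ≤ f x i := by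
    intro i
    have h1 := ((hcoord i).tendsto x).comp (hqx i)
    have h2 := (((hcoord i).comp hf).tendsto x).comp (hqx i)
    have h3 := h2.add hε
    rw [add_zero] at h3
    exact le_of_tendsto_of_tendsto' h1 h3 fun k => hq (φ k) i
  refine ⟨x, stdSimplex.ext (funext fun i => ?_)⟩
  have := (Finset.sum_eq_sum_iff_of_le (s := Finset.univ) fun i _ => hle i).mp
    (by rw [stdSimplex.sum_eq_one, stdSimplex.sum_eq_one])
  exact (this i (Finset.mem_univ i)).symm

/-! ### The infinite-dimensional simplex -/

/-- Finite partial sums express membership without reference to summability, which shows that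
`infSimplex` is closed in the product topology. -/
theorem mem_infSimplex_iff {x : ℕ → ℝ} :
    x ∈ infSimplex ↔ (∀ i, 0 ≤ x i) ∧ ∀ n, ∑ i ∈ Finset.range n, x i ≤ 1 := by
  constructor
  · rintro ⟨h0, hs, h1⟩
    exact ⟨h0, fun n => (hs.sum_le_tsum _ fun i _ => h0 i).trans h1⟩
  · rintro ⟨h0, h1⟩
    exact ⟨h0, summable_of_sum_range_le h0 h1, Real.tsum_le_of_sum_range_le h0 h1⟩

theorem isCompact_infSimplex : IsCompact infSimplex := by
  have hcl : IsClosed infSimplex := by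
    have : infSimplex = {x | ∀ i, 0 ≤ x i} ∩ {x | ∀ n, ∑ i ∈ Finset.range n, x i ≤ 1} :=
      Set.ext fun x => mem_infSimplex_iff
    rw [this]
    simp only [Set.ofPred_forall]
    refine (isClosed_iInter fun i => isClosed_le (by fun_prop) (by fun_prop)).inter
      (isClosed_iInter fun n => isClosed_le (by fun_prop) (by fun_prop))
  refine (isCompact_univ_pi fun _ : ℕ => isCompact_Icc (a := (0 : ℝ)) (b := 1)).of_isClosed_subset
    hcl fun x hx i _ => ⟨hx.1 i, ?_⟩
  exact (hx.2.1.le_tsum i fun j _ => hx.1 j).trans hx.2.2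

/-- The inclusion of the `n`-dimensional simplex into `infSimplex` as its first `n` coordinates.
The vertex `none` is the origin. -/
noncomputable def infSimplexIncl (n : ℕ) (x : stdSimplex ℝ (Option (Fin n))) : infSimplex :=
  ⟨fun j => if h : j < n then x (some ⟨j, h⟩) else 0, by
    have h0 : ∀ j, j ∉ Finset.range n → (if h : j < n then x (some ⟨j, h⟩) else 0) = 0 :=
      fun j hj => dif_neg (by simpa using hj)
    refine ⟨fun j => ?_, summable_of_ne_finset_zero h0, ?_⟩
    · dsimp only
      split_ifs
      · exact stdSimplex.zero_le x _
      · exact le_rfl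
    · rw [tsum_eq_sum h0, Finset.sum_range]
      have h1 := stdSimplex.sum_eq_one x
      rw [Fintype.sum_option] at h1
      simp only [Fin.is_lt, dif_pos, Fin.eta]
      linarith [stdSimplex.zero_le x none]⟩

theorem infSimplexIncl_apply {n : ℕ} (x : stdSimplex ℝ (Option (Fin n))) (j : Fin n) :
    (infSimplexIncl n x).1 j = x (some j) := by
  simp [infSimplexIncl]

theorem continuous_infSimplexIncl (n : ℕ) : Continuous (infSimplexIncl n) := by
  refine Continuous.subtype_mk (continuous_pi fun j => ?_) _
  by_cases h : j < n
  · simp only [h, dif_pos]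
    exact (continuous_apply _).comp continuous_subtype_val
  · simp only [h, dif_neg, not_false_eq_true]
    exact continuous_const

/-- The truncation to the first `n` coordinates. The barycentric coordinate of the
origin, indexed by `none`, is the complement of their sum to `1`. -/
def infSimplexTrunc (n : ℕ) (y : infSimplex) : stdSimplex ℝ (Option (Fin n)) :=
  ⟨fun o => o.elim (1 - ∑ i : Fin n, y.1 i) fun i => y.1 i, by
    constructor
    · rintro (_ | i)
      · have := (mem_infSimplex_iff.mp y.2).2 n
        rw [Finset.sum_range] at this
        exact sub_nonneg.mpr this
      · exact y.2.1 i
    · rw [Fintype.sum_option]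
      simp⟩

theorem infSimplexTrunc_apply {n : ℕ} (y : infSimplex) (i : Fin n) :
    infSimplexTrunc n y (some i) = y.1 i := rfl

theorem continuous_infSimplexTrunc (n : ℕ) : Continuous (infSimplexTrunc n) := by
  refine Continuous.subtype_mk (continuous_pi fun o => ?_) _
  have hc : ∀ i : ℕ, Continuous fun y : infSimplex => y.1 i := fun i =>
    (continuous_apply i).comp continuous_subtype_val
  rcases o with _ | i
  · exact continuous_const.sub (continuous_finsetSum _ fun i _ => hc i)
  · exact hc i

theorem theorem1 (f : infSimplex → infSimplex) (hf : Continuous f) :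
    ∃ x : infSimplex, f x = x := by
  have hn : ∀ n : ℕ, ∃ x : infSimplex, ∀ j < n, (f x).1 j = x.1 j := by
    intro n
    obtain ⟨z, hz⟩ := exists_fixedPoint_stdSimplex
      (infSimplexTrunc n ∘ f ∘ infSimplexIncl n)
      ((continuous_infSimplexTrunc n).comp (hf.comp (continuous_infSimplexIncl n)))
    refine ⟨infSimplexIncl n z, fun j hj => ?_⟩
    have h1 := infSimplexIncl_apply z ⟨j, hj⟩
    have h2 := infSimplexTrunc_apply (f (infSimplexIncl n z)) (⟨j, hj⟩ : Fin n)
    exact h2.symm.trans ((congrArg (fun w => w (some ⟨j, hj⟩)) hz).trans h1.symm)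
  choose x hx using hn
  have : CompactSpace infSimplex := isCompact_iff_compactSpace.mp isCompact_infSimplex
  obtain ⟨a, φ, hφ, ha⟩ := CompactSpace.tendsto_subseq x
  refine ⟨a, Subtype.ext (funext fun j => ?_)⟩
  have hc : Continuous fun y : infSimplex => y.1 j :=
    (continuous_apply j).comp continuous_subtype_val
  have h1 := (hc.tendsto a).comp ha
  have h2 := ((hc.comp hf).tendsto a).comp ha
  refine tendsto_nhds_unique (h2.congr' ?_) h1
  filter_upwards [Filter.eventually_gt_atTop j] with n hjn
  exact hx (φ n) j (hjn.trans_le hφ.le_apply)
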